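/- Let $\mathcal{O}\subset\mathbb{R}$ be a non-empty open interval (possibly unbounded), let $f$ be real analytic on $\mathcal{O}$ with $f''>0$ and $f'''>0$ on $\mathcal{O}$, and let $\mathcal{M}_{f,\mathcal{O}}$ be the pseudo-Riemannian manifold $\{(x,y,\tilde x,\tilde y)\in\mathbb{R}^4: y\in\mathcal{O}\}$ of signature $(2,2)$ with the metric $g_f$ whose only non-zero components, up to symmetry, are $$g_f(\partial_x,\partial_x)=-2f(y),\qquad g_f(\partial_x,\partial_{\tilde x})=g_f(\partial_y,\partial_{\tilde y})=1.$$ Put $\alpha_2:=f^{(4)}f^{(2)}(f^{(3)})^{-2}$. A pseudo-Riemannian manifold $\mathcal{M}$ is called locally homogeneous if for all points $P,Q$ of $\mathcal{M}$ there is an isometry from an open neighbourhood of $P$ onto an open neighbourhood of $Q$ which maps $P$ to $Q$. It is called $2$-curvature homogeneous if there are a finite-dimensional real vector space $V$, a non-degenerate symmetric inner product $\langle\cdot,\cdot\rangle$ on $V$ and tensors $A^i\in\otimes^{4+i}V^*$ ($i=0,1,2$) such that for every point $P$ there is a linear isomorphism $\Phi_P:T_P\mathcal{M}\to V$ with $\Phi_P^*\langle\cdot,\cdot\rangle=g|_{T_P\mathcal{M}}$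 and $\Phi_P^*A^i=\nabla^iR|_{T_P\mathcal{M}}$ for $i=0,1,2$, where $\nabla^iR$ is the $i$-th covariant derivative of the curvature tensor. **Theorem 1.8.** The following assertions are equivalent: 1. $\mathcal{M}_{f,\mathcal{O}}$ is locally homogeneous. 2. $\mathcal{M}_{f,\mathcal{O}}$ is $2$-curvature homogeneous. 3. $\alpha_2$ is constant on $\mathcal{O}$. 4. Either there are $a,b,c\in\mathbb{R}$ such that $y+b\neq0$ and $f''(y)=a|y+b|^c$ for all $y\in\mathcal{O}$, or there are $a,\lambda\in\mathbb{R}$ such that $f''(y)=ae^{\lambda y}$ for all $y\in\mathcal{O}$. -/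

import Mathlib

open scoped ContDiff

noncomputable section

/-- A pseudo-Riemannian manifold given in one global chart: an open subset of `ℝⁿ` with a smooth
field of symmetric non-degenerate matrices `g p`, where `g p i j = g(∂ᵢ, ∂ⱼ)` at the point `p`.
The values of `g` outside the carrier are irrelevant. -/
structure PseudoRiemannianDomain (n : ℕ) where
  carrier : Set (Fin n → ℝ)
  isOpen_carrier : IsOpen carrier
  g : (Fin n → ℝ) → Matrix (Fin n) (Fin n) ℝ
  smooth : ∀ i j, ContDiffOn ℝ ∞ (fun p => g p i j) carrier
  symm : ∀ p ∈ carrier, (g p).IsSymm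
  nondegenerate : ∀ p ∈ carrier, IsUnit (g p).det

/-- The components `T_I = T(∂_{I 0}, …, ∂_{I (r-1)})` of a covariant `r`-tensor field in the
standard coordinates of `ℝⁿ`. -/
abbrev TensorComponents (n r : ℕ) : Type := (Fin n → ℝ) → (Fin r → Fin n) → ℝ

/-- The partial derivative `∂ᵢ F` of a function at `p`. -/
def partialDeriv {n : ℕ} (i : Fin n) (F : (Fin n → ℝ) → ℝ) (p : Fin n → ℝ) : ℝ :=
  fderiv ℝ F p (Pi.single i 1)

/-- The covariant tensor with given components, as a multilinear form:
`T(v₁, …, v_r) = ∑_I T_I ∏ₛ (vₛ)_{I s}`. -/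
def tensorOfComponents {n r : ℕ} (T : (Fin r → Fin n) → ℝ) :
    MultilinearMap ℝ (fun _ : Fin r => Fin n → ℝ) ℝ :=
  ∑ I : Fin r → Fin n, T I •
    (MultilinearMap.mkPiAlgebra ℝ (Fin r) ℝ).compLinearMap (fun s => LinearMap.proj (I s))

namespace PseudoRiemannianDomain

variable {n : ℕ} (M : PseudoRiemannianDomain n)

/-- The metric at `p`, as a bilinear form on the tangent space `T_pM = ℝⁿ`. -/
def inner (p : Fin n → ℝ) : LinearMap.BilinForm ℝ (Fin n → ℝ) := Matrix.toBilin' (M.g p)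

/-- The Christoffel symbols of the Levi-Civita connection, `∇_{∂ᵢ} ∂ⱼ = ∑ₘ Γᵐᵢⱼ ∂ₘ`;
`M.christoffel m i j p` is `Γᵐᵢⱼ` at `p`. -/
def christoffel (m i j : Fin n) (p : Fin n → ℝ) : ℝ :=
  (1 / 2) * ∑ l, (M.g p)⁻¹ m l *
    (partialDeriv i (fun q => M.g q j l) p + partialDeriv j (fun q => M.g q i l) p
      - partialDeriv l (fun q => M.g q i j) p)

/-- The coefficient of `∂ₘ` in `R(∂ᵢ, ∂ⱼ) ∂ₖ = (∇_{∂ᵢ} ∇_{∂ⱼ} - ∇_{∂ⱼ} ∇_{∂ᵢ}) ∂ₖ`. -/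
def curvatureOperator (i j k m : Fin n) (p : Fin n → ℝ) : ℝ :=
  partialDeriv i (M.christoffel m j k) p - partialDeriv j (M.christoffel m i k) p
    + ∑ l, (M.christoffel m i l p * M.christoffel l j k p
      - M.christoffel m j l p * M.christoffel l i k p)

/-- The curvature tensor `R(∂ᵢ, ∂ⱼ, ∂ₖ, ∂ₗ) = g(R(∂ᵢ, ∂ⱼ) ∂ₖ, ∂ₗ)`. -/
def curvature : TensorComponents n 4 := fun p I =>
  ∑ m, M.curvatureOperator (I 0) (I 1) (I 2) m p * M.g p m (I 3)

/-- The covariant derivative of a covariant tensor field; the direction of differentiation is the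
last argument:
`(∇T)(∂_{i₁}, …, ∂_{i_r}; ∂ⱼ) = ∂ⱼ T_{i₁…i_r} - ∑ₛ T(∂_{i₁}, …, ∇_{∂ⱼ} ∂_{iₛ}, …, ∂_{i_r})`. -/
def covDeriv {r : ℕ} (T : TensorComponents n r) : TensorComponents n (r + 1) := fun p J =>
  partialDeriv (J (Fin.last r)) (fun q => T q (Fin.init J)) p
    - ∑ s : Fin r, ∑ m : Fin n, M.christoffel m (J (Fin.last r)) (J s.castSucc) p
        * T p (Function.update (Fin.init J) s m)

/-- The components of `∇ᵏR`. -/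
def nablaR : (k : ℕ) → TensorComponents n (4 + k)
  | 0 => M.curvature
  | k + 1 => M.covDeriv (nablaR k)

/-- `∇ᵏR` at `p`, as a multilinear form on `T_pM`. -/
def nablaRAt (k : ℕ) (p : Fin n → ℝ) :
    MultilinearMap ℝ (fun _ : Fin (4 + k) => Fin n → ℝ) ℝ :=
  tensorOfComponents (M.nablaR k p)

end PseudoRiemannianDomain

/-- An algebraic model `(V, ⟨·,·⟩, A⁰, …, Aᵏ)`: a finite-dimensional real vector space with a
non-degenerate symmetric inner product and tensors `Aⁱ ∈ ⊗⁴⁺ⁱ V*`. -/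
structure CurvatureModel (k : ℕ) where
  V : Type
  [addCommGroup : AddCommGroup V]
  [module : Module ℝ V]
  [finiteDimensional : FiniteDimensional ℝ V]
  inner : LinearMap.BilinForm ℝ V
  inner_symm : inner.IsSymm
  inner_nondegenerate : inner.Nondegenerate
  A : (i : Fin (k + 1)) → MultilinearMap ℝ (fun _ : Fin (4 + (i : ℕ)) => V) ℝ

attribute [instance] CurvatureModel.addCommGroup CurvatureModel.module
  CurvatureModel.finiteDimensional

namespace PseudoRiemannianDomain

variable {n : ℕ} (M : PseudoRiemannianDomain n)

/-- `U` is a `k`-model for `M`: at each point `p` of `M` there is a linear isomorphism `Φ` from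
`T_pM` to `V` with `Φ^*⟨·,·⟩ = g_p` and `Φ^* Aⁱ = ∇ⁱR_p` for `0 ≤ i ≤ k`. -/
def HasModel {k : ℕ} (U : CurvatureModel k) : Prop :=
  ∀ p ∈ M.carrier, ∃ Φ : (Fin n → ℝ) ≃ₗ[ℝ] U.V,
    (∀ v w, U.inner (Φ v) (Φ w) = M.inner p v w) ∧
    ∀ i : Fin (k + 1),
      (U.A i).compLinearMap (fun _ => (Φ : (Fin n → ℝ) →ₗ[ℝ] U.V)) = M.nablaRAt i p

/-- `M` is `k`-curvature homogeneous: it admits a `k`-model. -/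
def CurvatureHomogeneous (k : ℕ) : Prop := ∃ U : CurvatureModel k, M.HasModel U

/-- `φ` is a local isometry of `M`: a smooth diffeomorphism between two open subsets of `M` that
preserves the metric. -/
def IsLocalIsometry (φ : OpenPartialHomeomorph (Fin n → ℝ) (Fin n → ℝ)) : Prop :=
  φ.source ⊆ M.carrier ∧ φ.target ⊆ M.carrier ∧
  ContDiffOn ℝ ∞ φ φ.source ∧ ContDiffOn ℝ ∞ φ.symm φ.target ∧
  ∀ p ∈ φ.source, ∀ v w,
    M.inner (φ p) (fderiv ℝ φ p v) (fderiv ℝ φ p w) = M.inner p v w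

/-- `M` is locally homogeneous: any two points `p`, `q` have open neighbourhoods with an isometry
between them that takes `p` to `q`. -/
def LocallyHomogeneous : Prop :=
  ∀ p ∈ M.carrier, ∀ q ∈ M.carrier, ∃ φ : OpenPartialHomeomorph (Fin n → ℝ) (Fin n → ℝ),
    M.IsLocalIsometry φ ∧ p ∈ φ.source ∧ φ p = q

end PseudoRiemannianDomain

/-- The matrix of `g_f` in the coordinates `(x, y, x̃, ỹ)`, numbered `0, 1, 2, 3`: the only
non-zero entries, up to symmetry, are `g(∂x, ∂x) = -2 f(y)` and `g(∂x, ∂x̃) = g(∂y, ∂ỹ) = 1`. -/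
def planeWaveMatrix (f : ℝ → ℝ) (p : Fin 4 → ℝ) : Matrix (Fin 4) (Fin 4) ℝ :=
  !![-2 * f (p 1), 0, 1, 0;
     0, 0, 0, 1;
     1, 0, 0, 0;
     0, 1, 0, 0]

/-- The generalized plane wave manifold `M_{f,O} = ({(x, y, x̃, ỹ) ∈ ℝ⁴ : y ∈ O}, g_f)`. -/
def planeWave (f : ℝ → ℝ) (O : Set ℝ) (hO : IsOpen O) (hf : AnalyticOnNhd ℝ f O) :
    PseudoRiemannianDomain 4 where
  carrier := {p | p 1 ∈ O}
  isOpen_carrier := hO.preimage (continuous_apply 1)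
  g := planeWaveMatrix f
  smooth := by
    have h : ContDiffOn ℝ ∞ (fun p : Fin 4 → ℝ => f (p 1)) {p | p 1 ∈ O} :=
      (hf.contDiffOn hO.uniqueDiffOn).comp (contDiff_apply ℝ ℝ (1 : Fin 4)).contDiffOn
        (fun _ hp => hp)
    intro i j
    fin_cases i <;> fin_cases j <;>
      simp [planeWaveMatrix] <;> first | exact contDiffOn_const | skip
    exact (contDiffOn_const.mul h).neg
  symm := by
    intro p _
    ext i j
    fin_cases i <;> fin_cases j <;> simp [planeWaveMatrix]
  nondegenerate := by
    intro p _
    simp [planeWaveMatrix, Matrix.det_succ_row_zero, Fin.sum_univ_succ, Fin.succAbove]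

/-- `α₂(f) = f⁽⁴⁾ f⁽²⁾ (f⁽³⁾)⁻²`. -/
def alphaTwo (f : ℝ → ℝ) (y : ℝ) : ℝ :=
  iteratedDeriv 4 f y * iteratedDeriv 2 f y / iteratedDeriv 3 f y ^ 2

end

/-! The only non-zero Christoffel symbols have upper index x̃ or ỹ and lower indices among x, y.
Hence their quadratic terms vanish, covariant derivatives of R reduce to ∂_y, and ∇ᵏR = −f⁽ᵏ⁺²⁾(y)
(dx∧dy)⊗(dx∧dy)⊗dyᵏ (`nablaRAt_planeWave`, `tensorOfComponents_planeWaveSymbol`). A linear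
isomorphism of tangent spaces matching these tensors for k = 0, 1, 2 relates the values of f'',
f''', f'''' at the two points by factors D², D²E, D²E², and these cancel in α₂
(`alphaTwo_eq_of_scaling`). Conversely, rescaling a frame normalises f'' = f''' = 1, which leaves
f'''' = α₂; so 2 and 3 are equivalent.

If α₂ = k then (f''/f''')' = 1 − k, and two integrations give the power law or the exponential
(`exists_power_or_exp`). Each of these is self-similar under affine maps of y moving any point to
any other, and such a map lifts to an isometry (`exists_isLocalIsometry_planeWave`); so 3 implies 4
and 4 implies 1.

For 1 implies 3, integrability of the isometry equations forces the x- and y-components of an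
isometry to have zero Hessian and to be independent of x̃, ỹ to first order (`fderiv_component`). A
second integrability condition yields the factor D² for f'' (`iteratedDeriv_two_planeJacobian`);
differentiating it in y gives the other two factors. -/

/-! ### Partial derivatives. -/

section Calculus

variable {n : ℕ} {i j : Fin n} {p : Fin n → ℝ} {F G : (Fin n → ℝ) → ℝ} {U : Set (Fin n → ℝ)}

theorem partialDeriv_const (c : ℝ) : partialDeriv i (fun _ => c) p = 0 := by
  simp [partialDeriv]

theorem partialDeriv_add (hF : DifferentiableAt ℝ F p) (hG : DifferentiableAt ℝ G p) :
    partialDeriv i (fun q => F q + G q) p = partialDeriv i F p + partialDeriv i G p := by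
  simp [partialDeriv, fderiv_fun_add hF hG]

theorem partialDeriv_mul (hF : DifferentiableAt ℝ F p) (hG : DifferentiableAt ℝ G p) :
    partialDeriv i (fun q => F q * G q) p = F p * partialDeriv i G p + G p * partialDeriv i F p := by
  simp [partialDeriv, fderiv_fun_mul hF hG]

theorem partialDeriv_comp {h : ℝ → ℝ} {h' : ℝ} (hh : HasDerivAt h h' (F p))
    (hF : DifferentiableAt ℝ F p) :
    partialDeriv i (fun q => h (F q)) p = h' * partialDeriv i F p := by
  have := (hh.comp_hasFDerivAt p hF.hasFDerivAt).fderiv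
  simp only [Function.comp_def] at this
  simp [partialDeriv, this]

theorem partialDeriv_apply (k : Fin n) :
    partialDeriv i (fun q => q k) p = if k = i then 1 else 0 := by
  simp [partialDeriv, (hasFDerivAt_apply (𝕜 := ℝ) k p).fderiv, Pi.single_apply]

theorem partialDeriv_comp_apply {h : ℝ → ℝ} {h' : ℝ} (k : Fin n) (hh : HasDerivAt h h' (p k)) :
    partialDeriv i (fun q => h (q k)) p = if k = i then h' else 0 := by
  rw [partialDeriv_comp (F := fun q => q k) hh (by fun_prop), partialDeriv_apply]
  simp

theorem partialDeriv_congr (hU : IsOpen U) (hp : p ∈ U) (h : ∀ q ∈ U, F q = G q) :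
    partialDeriv i F p = partialDeriv i G p := by
  rw [partialDeriv, partialDeriv,
    Filter.EventuallyEq.fderiv_eq (Filter.eventually_of_mem (hU.mem_nhds hp) h)]

theorem contDiffOn_partialDeriv (hU : IsOpen U) (hF : ContDiffOn ℝ ∞ F U) :
    ContDiffOn ℝ ∞ (partialDeriv i F) U :=
  (hF.fderiv_of_isOpen hU (by simp)).clm_apply contDiffOn_const

theorem partialDeriv_comm (hU : IsOpen U) (hF : ContDiffOn ℝ ∞ F U) (hp : p ∈ U) :
    partialDeriv i (partialDeriv j F) p = partialDeriv j (partialDeriv i F) p := by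
  have hs : IsSymmSndFDerivAt ℝ F p :=
    (hF.contDiffAt (hU.mem_nhds hp)).isSymmSndFDerivAt
      (by simpa using WithTop.coe_le_coe.2 (le_top : (2 : ℕ∞) ≤ ⊤))
  have hd : DifferentiableAt ℝ (fderiv ℝ F) p :=
    ((hF.fderiv_of_isOpen hU (m := ∞) (by simp)).contDiffAt
      (hU.mem_nhds hp)).differentiableAt (by simp)
  have key (i j : Fin n) : partialDeriv i (partialDeriv j F) p =
      fderiv ℝ (fderiv ℝ F) p (Pi.single i 1) (Pi.single j 1) := by
    have : partialDeriv j F = fun q => fderiv ℝ F q (Pi.single j 1) := rfl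
    rw [this, partialDeriv, fderiv_clm_apply hd (by fun_prop)]
    simp
  rw [key, key, hs.eq]

end Calculus

theorem hasDerivAt_iteratedDeriv {O : Set ℝ} {f : ℝ → ℝ} (hf : AnalyticOnNhd ℝ f O) (k : ℕ) {y : ℝ}
    (hy : y ∈ O) : HasDerivAt (iteratedDeriv k f) (iteratedDeriv (k + 1) f y) y := by
  rw [iteratedDeriv_succ]
  refine DifferentiableAt.hasDerivAt ?_
  rw [iteratedDeriv_eq_iterate]
  exact (hf.iterated_deriv k y hy).differentiableAt

/-! ### Christoffel symbols and curvature operator. -/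

theorem planeWave_inner (f : ℝ → ℝ) (O : Set ℝ) (hO : IsOpen O) (hf : AnalyticOnNhd ℝ f O)
    (p v w : Fin 4 → ℝ) :
    (planeWave f O hO hf).inner p v w =
      -2 * f (p 1) * v 0 * w 0 + v 0 * w 2 + v 2 * w 0 + v 1 * w 3 + v 3 * w 1 := by
  simp [PseudoRiemannianDomain.inner, planeWave, planeWaveMatrix, Matrix.toBilin'_apply,
    Fin.sum_univ_four]
  ring

theorem planeWaveMatrix_inv (f : ℝ → ℝ) (p : Fin 4 → ℝ) :
    (planeWaveMatrix f p)⁻¹ = !![0, 0, 1, 0; 0, 0, 0, 1; 1, 0, 2 * f (p 1), 0; 0, 1, 0, 0] := by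
  refine Matrix.inv_eq_right_inv ?_
  ext i j
  fin_cases i <;> fin_cases j <;>
    simp [planeWaveMatrix, Matrix.mul_apply, Fin.sum_univ_four]

/-- The Christoffel symbols of `planeWave f O`, divided by `f'`. -/
def planeWaveChristoffel (m i j : Fin 4) : ℤ :=
  if m = 3 ∧ i = 0 ∧ j = 0 then 1
  else if m = 2 ∧ (i = 0 ∧ j = 1 ∨ i = 1 ∧ j = 0) then -1 else 0

section PlaneWave

variable {f : ℝ → ℝ} {O : Set ℝ} (hO : IsOpen O) (hf : AnalyticOnNhd ℝ f O)
include hf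

theorem partialDeriv_planeWaveMatrix {p : Fin 4 → ℝ} (hp : p 1 ∈ O) (i j l : Fin 4) :
    partialDeriv l (fun q => planeWaveMatrix f q i j) p =
      if i = 0 ∧ j = 0 ∧ l = 1 then -2 * iteratedDeriv 1 f (p 1) else 0 := by
  have h := partialDeriv_comp_apply (p := p) (i := l) 1 (by
    simpa using (hasDerivAt_iteratedDeriv hf 0 hp).const_mul (-2))
  fin_cases i <;> fin_cases j <;>
    first
    | simpa [planeWaveMatrix, eq_comm] using h
    | simp [planeWaveMatrix, partialDeriv_const]

theorem christoffel_planeWave {p : Fin 4 → ℝ} (hp : p 1 ∈ O) (m i j : Fin 4) :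
    (planeWave f O hO hf).christoffel m i j p =
      planeWaveChristoffel m i j * iteratedDeriv 1 f (p 1) := by
  simp only [PseudoRiemannianDomain.christoffel, planeWave, partialDeriv_planeWaveMatrix hf hp,
    planeWaveMatrix_inv, Fin.sum_univ_four]
  fin_cases m <;> fin_cases i <;> fin_cases j <;> simp [planeWaveChristoffel]

theorem partialDeriv_iteratedDeriv_mul {p : Fin 4 → ℝ} (hp : p 1 ∈ O) (k : ℕ) (c : ℝ) (i : Fin 4) :
    partialDeriv i (fun q => c * iteratedDeriv k f (q 1)) p =
      c * (if i = 1 then 1 else 0) * iteratedDeriv (k + 1) f (p 1) := by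
  rw [partialDeriv_comp_apply (h := fun y => c * iteratedDeriv k f y) 1
    ((hasDerivAt_iteratedDeriv hf k hp).const_mul c)]
  simp [eq_comm]

theorem curvatureOperator_planeWave {p : Fin 4 → ℝ} (hp : p 1 ∈ O) (i j k m : Fin 4) :
    (planeWave f O hO hf).curvatureOperator i j k m p =
      ((if i = 1 then 1 else 0) * planeWaveChristoffel m j k
        - (if j = 1 then 1 else 0) * planeWaveChristoffel m i k : ℤ)
        * iteratedDeriv 2 f (p 1) := by
  have hU : IsOpen {q : Fin 4 → ℝ | q 1 ∈ O} := hO.preimage (continuous_apply 1)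
  have hd (a b c d : Fin 4) : partialDeriv d ((planeWave f O hO hf).christoffel a b c) p =
      planeWaveChristoffel a b c * (if d = 1 then 1 else 0) * iteratedDeriv 2 f (p 1) := by
    rw [partialDeriv_congr hU hp (fun q hq => christoffel_planeWave hO hf hq a b c),
      partialDeriv_iteratedDeriv_mul hf hp]
  -- The second factor needs c to be 2 or 3, the first needs c to be 0 or 1.
  have hz : ∀ a b c d e : Fin 4,
      planeWaveChristoffel a b c * planeWaveChristoffel c d e = 0 := by decide
  have hz' (a b c d e : Fin 4) (t : ℝ) : (planeWaveChristoffel a b c : ℝ) * t *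
      (planeWaveChristoffel c d e * t) = 0 := by
    rw [mul_mul_mul_comm, ← Int.cast_mul, hz]; simp
  simp only [PseudoRiemannianDomain.curvatureOperator, hd, christoffel_planeWave hO hf hp, hz', sub_self, Finset.sum_const_zero, add_zero]
  push_cast
  ring

end PlaneWave

/-! ### The tensors ∇ᵏR. -/

/-- The coefficient of `f⁽ᵏ⁺²⁾` in the components of `∇ᵏR` on `planeWave f O`: a signed count of
the index words `0110`, `1001`, `0101`, `1010`, all followed by `1…1`. -/
def planeWaveSymbol (k : ℕ) (I : Fin (4 + k) → Fin 4) : ℝ :=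
  (if I = Fin.append ![0, 1, 1, 0] (fun _ => 1) then 1 else 0)
  + (if I = Fin.append ![1, 0, 0, 1] (fun _ => 1) then 1 else 0)
  - (if I = Fin.append ![0, 1, 0, 1] (fun _ => 1) then 1 else 0)
  - (if I = Fin.append ![1, 0, 1, 0] (fun _ => 1) then 1 else 0)

/-- The words use only the letters 0 and 1, so ∂x̃ and ∂ỹ are annihilated in every slot; this kills
the connection terms of ∇. -/
theorem planeWaveSymbol_eq_zero {k : ℕ} {I : Fin (4 + k) → Fin 4} {s : Fin (4 + k)}
    (hs : 2 ≤ I s) : planeWaveSymbol k I = 0 := by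
  have h (w : Fin 4 → Fin 4) (hw : ∀ t, w t < 2) :
      I ≠ Fin.append w (fun _ : Fin k => 1) := by
    rintro rfl
    refine absurd hs (not_le.2 ?_)
    refine Fin.addCases (fun t => ?_) (fun t => ?_) s <;> simp [hw]
  simp [planeWaveSymbol, h ![0, 1, 1, 0] (by decide), h ![1, 0, 0, 1] (by decide),
    h ![0, 1, 0, 1] (by decide), h ![1, 0, 1, 0] (by decide)]

/-- Each word for k + 1 is a word for k with a final 1: the symbol is tensored with dy. -/
theorem planeWaveSymbol_succ {k : ℕ} (J : Fin (4 + k + 1) → Fin 4) :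
    planeWaveSymbol (k + 1) J =
      planeWaveSymbol k (Fin.init J) * if J (Fin.last _) = 1 then 1 else 0 := by
  have h (w : Fin 4 → Fin 4) :
      J = (Fin.append w (fun _ : Fin (k + 1) => 1) : Fin (4 + (k + 1)) → Fin 4) ↔
      Fin.init J = Fin.append w (fun _ : Fin k => 1) ∧ J (Fin.last _) = 1 := by
    have : (Fin.append w (fun _ : Fin (k + 1) => 1) : Fin (4 + (k + 1)) → Fin 4) =
        Fin.snoc (α := fun _ => Fin 4) (Fin.append w (fun _ : Fin k => 1)) 1 := by
      rw [← Fin.append_snoc]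
      congr 1
      ext t
      refine Fin.lastCases ?_ (fun t => ?_) t <;> simp
    rw [this, ← Fin.snoc_init_self J, Fin.snoc_inj]
    simp
  by_cases hJ : J (Fin.last _) = 1 <;> simp [planeWaveSymbol, h, hJ]

section PlaneWave

variable {f : ℝ → ℝ} {O : Set ℝ} (hO : IsOpen O) (hf : AnalyticOnNhd ℝ f O)
include hf

theorem curvature_planeWave {p : Fin 4 → ℝ} (hp : p 1 ∈ O) (I : Fin 4 → Fin 4) :
    (planeWave f O hO hf).curvature p I =
      planeWaveSymbol 0 I * iteratedDeriv 2 f (p 1) := by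
  have hcomp (a b c d : Fin 4) : (I = Fin.append ![a, b, c, d] (fun _ : Fin 0 => 1)) ↔
      I 0 = a ∧ I 1 = b ∧ I 2 = c ∧ I 3 = d := by
    have : (Fin.append ![a, b, c, d] (fun _ : Fin 0 => 1) : Fin 4 → Fin 4) = ![a, b, c, d] := by
      ext t; exact congrArg Fin.val (Fin.append_left ![a, b, c, d] _ t)
    rw [this]
    refine ⟨by rintro rfl; simp, fun h => ?_⟩
    ext t; fin_cases t <;> simp [h]
  simp only [PseudoRiemannianDomain.curvature, curvatureOperator_planeWave hO hf hp,
    Fin.sum_univ_four, planeWaveSymbol, hcomp]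
  generalize I 0 = a, I 1 = b, I 2 = c, I 3 = d
  have h01 : ∀ i j, planeWaveChristoffel 0 i j = 0 ∧ planeWaveChristoffel 1 i j = 0 := by decide
  have hg : (planeWave f O hO hf).g p 2 d = (if d = 0 then 1 else 0 : ℤ) ∧
      (planeWave f O hO hf).g p 3 d = (if d = 1 then 1 else 0 : ℤ) := by
    fin_cases d <;> simp [planeWave, planeWaveMatrix]
  -- With the factor f'' removed, both sides are integer functions of four indices in a finite set,
  -- so the identity is decidable.
  have key : ∀ a b c d : Fin 4,
      ((if a = 1 then 1 else 0) * planeWaveChristoffel 2 b c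
        - (if b = 1 then 1 else 0) * planeWaveChristoffel 2 a c) * (if d = 0 then 1 else 0)
      + ((if a = 1 then 1 else 0) * planeWaveChristoffel 3 b c
        - (if b = 1 then 1 else 0) * planeWaveChristoffel 3 a c) * (if d = 1 then 1 else 0)
      = (if a = 0 ∧ b = 1 ∧ c = 1 ∧ d = 0 then 1 else 0)
        + (if a = 1 ∧ b = 0 ∧ c = 0 ∧ d = 1 then 1 else 0)
        - (if a = 0 ∧ b = 1 ∧ c = 0 ∧ d = 1 then 1 else 0)
        - (if a = 1 ∧ b = 0 ∧ c = 1 ∧ d = 0 then 1 else 0) := by decide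
  have hkey := congrArg (fun z : ℤ => (z : ℝ) * iteratedDeriv 2 f (p 1)) (key a b c d)
  rw [hg.1, hg.2]
  simp only [h01]
  push_cast at hkey ⊢
  rw [← hkey]
  ring

/-- The Christoffel symbol vanishes unless m is 2 or 3, and for those m the tensor with m inserted
vanishes. Only the partial derivative remains, and it sees y alone. -/
theorem covDeriv_planeWave {r : ℕ} {T : TensorComponents 4 r} {c : (Fin r → Fin 4) → ℝ} {k : ℕ}
    (hT : ∀ q : Fin 4 → ℝ, q 1 ∈ O → ∀ I, T q I = c I * iteratedDeriv k f (q 1))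
    (hc : ∀ I s, 2 ≤ I s → c I = 0) {p : Fin 4 → ℝ} (hp : p 1 ∈ O) (J : Fin (r + 1) → Fin 4) :
    (planeWave f O hO hf).covDeriv T p J =
      c (Fin.init J) * (if J (Fin.last r) = 1 then 1 else 0) * iteratedDeriv (k + 1) f (p 1) := by
  have hU : IsOpen {q : Fin 4 → ℝ | q 1 ∈ O} := hO.preimage (continuous_apply 1)
  have hz (s : Fin r) (m : Fin 4) :
      (planeWave f O hO hf).christoffel m (J (Fin.last r)) (J s.castSucc) p
        * T p (Function.update (Fin.init J) s m) = 0 := by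
    rw [christoffel_planeWave hO hf hp, hT p hp]
    by_cases hm : 2 ≤ m
    · rw [hc _ s (by simpa using hm)]; simp
    · have : ∀ m i j : Fin 4, ¬ 2 ≤ m → planeWaveChristoffel m i j = 0 := by decide
      rw [this m _ _ hm]; simp
  rw [PseudoRiemannianDomain.covDeriv, partialDeriv_congr hU hp (fun q hq => hT q hq _),
    partialDeriv_iteratedDeriv_mul hf hp]
  simp only [hz, Finset.sum_const_zero, sub_zero]

theorem nablaR_planeWave (k : ℕ) {p : Fin 4 → ℝ} (hp : p 1 ∈ O) (I : Fin (4 + k) → Fin 4) :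
    (planeWave f O hO hf).nablaR k p I =
      planeWaveSymbol k I * iteratedDeriv (k + 2) f (p 1) := by
  induction k generalizing p with
  | zero => exact curvature_planeWave hO hf hp I
  | succ k ih =>
    refine (covDeriv_planeWave hO hf (fun q hq I => ih hq I)
      (fun I s hs => planeWaveSymbol_eq_zero hs) hp I).trans ?_
    rw [planeWaveSymbol_succ, show k + 1 + 2 = k + 2 + 1 by ring]

theorem nablaRAt_planeWave (k : ℕ) {p : Fin 4 → ℝ} (hp : p 1 ∈ O) (v : Fin (4 + k) → Fin 4 → ℝ) :
    (planeWave f O hO hf).nablaRAt k p v =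
      iteratedDeriv (k + 2) f (p 1) * tensorOfComponents (planeWaveSymbol k) v := by
  have : (planeWave f O hO hf).nablaR k p =
      fun I => planeWaveSymbol k I * iteratedDeriv (k + 2) f (p 1) :=
    funext (nablaR_planeWave hO hf k hp)
  rw [PseudoRiemannianDomain.nablaRAt, this]
  simp only [tensorOfComponents, sum_apply, smul_apply, smul_eq_mul,
    Finset.mul_sum]
  exact Finset.sum_congr rfl fun _ _ => by ring

end PlaneWave

/-- The four words are the expansion of −(dx∧dy)⊗(dx∧dy), the trailing ones that of dyᵏ. -/
theorem tensorOfComponents_planeWaveSymbol (k : ℕ) (v : Fin (4 + k) → Fin 4 → ℝ) :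
    tensorOfComponents (planeWaveSymbol k) v =
      (v (Fin.castAdd k 0) 1 * v (Fin.castAdd k 1) 0 - v (Fin.castAdd k 0) 0 * v (Fin.castAdd k 1) 1)
      * (v (Fin.castAdd k 2) 0 * v (Fin.castAdd k 3) 1
        - v (Fin.castAdd k 2) 1 * v (Fin.castAdd k 3) 0)
      * ∏ s : Fin k, v (Fin.natAdd 4 s) 1 := by
  simp only [tensorOfComponents, planeWaveSymbol, sum_apply,
    smul_apply, smul_eq_mul, MultilinearMap.compLinearMap_apply,
    MultilinearMap.mkPiAlgebra_apply, LinearMap.proj_apply, sub_mul, add_mul,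
    Finset.sum_sub_distrib, Finset.sum_add_distrib, ite_mul, one_mul, zero_mul,
    Finset.sum_ite_eq', Finset.mem_univ, if_true, Fin.prod_univ_add, Fin.append_left,
    Fin.append_right, Fin.prod_univ_four]
  simp
  ring

/-! ### The differential equation α₂ = k. -/

section ODE

variable {O : Set ℝ} {h h₁ h₂ : ℝ → ℝ}

/-- On a convex set, two functions with the same derivative differ by a constant. -/
theorem Convex.eq_add_const_of_hasDerivAt {W : Set ℝ} (hW : Convex ℝ W) {u v w : ℝ → ℝ}
    (hu : ∀ y ∈ W, HasDerivAt u (w y) y) (hv : ∀ y ∈ W, HasDerivAt v (w y) y) :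
    ∃ c, ∀ y ∈ W, u y = v y + c := by
  rcases W.eq_empty_or_nonempty with rfl | ⟨y₀, hy₀⟩
  · exact ⟨0, by simp⟩
  refine ⟨u y₀ - v y₀, fun y hy => ?_⟩
  have := hW.norm_image_sub_le_of_norm_hasDerivWithin_le (C := 0)
    (fun z hz => ((hu z hz).sub (hv z hz)).hasDerivWithinAt) (by simp) hy₀ hy
  rw [zero_mul, norm_le_zero_iff] at this
  simp only [Pi.sub_apply] at this
  linarith

/-- Since (h/h')' = 1 − h''h/h'² = 1 − k, the quotient h/h' is affine and log h is a primitive of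
its reciprocal: linear if k = 1, logarithmic otherwise. -/
theorem exists_power_or_exp (hW : Convex ℝ O) (hh : ∀ y ∈ O, HasDerivAt h (h₁ y) y)
    (hh₁ : ∀ y ∈ O, HasDerivAt h₁ (h₂ y) y) (hpos : ∀ y ∈ O, 0 < h y) (hpos₁ : ∀ y ∈ O, 0 < h₁ y)
    {k : ℝ} (hk : ∀ y ∈ O, h₂ y * h y / h₁ y ^ 2 = k) :
    (∃ a b c : ℝ, ∀ y ∈ O, y + b ≠ 0 ∧ h y = a * |y + b| ^ c) ∨
      (∃ a l : ℝ, ∀ y ∈ O, h y = a * Real.exp (l * y)) := by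
  obtain ⟨d, hd⟩ : ∃ d, ∀ y ∈ O, h y / h₁ y = (1 - k) * y + d := by
    refine hW.eq_add_const_of_hasDerivAt (w := fun _ => 1 - k) (fun y hy => ?_) (fun y hy => ?_)
    · refine ((hh y hy).div (hh₁ y hy) (hpos₁ y hy).ne').congr_deriv ?_
      rw [← hk y hy]
      have := (hpos₁ y hy).ne'
      field_simp
    · simpa using (hasDerivAt_id y).const_mul (1 - k)
  have hd' (y : ℝ) (hy : y ∈ O) : 0 < (1 - k) * y + d := by
    rw [← hd y hy]; exact div_pos (hpos y hy) (hpos₁ y hy)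
  have hlog (y : ℝ) (hy : y ∈ O) :
      HasDerivAt (fun y => Real.log (h y)) (((1 - k) * y + d)⁻¹) y := by
    refine ((hh y hy).log (hpos y hy).ne').congr_deriv ?_
    rw [← hd y hy, inv_div]
  by_cases hk1 : 1 - k = 0
  · right
    simp only [hk1, zero_mul, zero_add] at hlog
    obtain ⟨c, hc⟩ := hW.eq_add_const_of_hasDerivAt hlog (v := fun y => d⁻¹ * y)
      (fun y _ => by simpa using (hasDerivAt_id y).const_mul d⁻¹)
    refine ⟨Real.exp c, d⁻¹, fun y hy => ?_⟩
    rw [← Real.exp_add, add_comm, ← hc y hy, Real.exp_log (hpos y hy)]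
  · left
    have hne (y : ℝ) (hy : y ∈ O) : y + d / (1 - k) ≠ 0 := by
      intro h0
      have := hd' y hy
      have e : (1 - k) * y + d = (1 - k) * (y + d / (1 - k)) := by field_simp
      rw [e, h0] at this; simp at this
    -- `Real.log` is log|·|, so one primitive serves both signs of y + d/(1 − k).
    obtain ⟨c, hc⟩ := hW.eq_add_const_of_hasDerivAt hlog
      (v := fun y => (1 - k)⁻¹ * Real.log (y + d / (1 - k))) (fun y hy => by
        refine ((((hasDerivAt_id y).add_const (d / (1 - k))).log (hne y hy)).const_mul
          (1 - k)⁻¹).congr_deriv ?_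
        have := hne y hy
        have := (hd' y hy).ne'
        have e : (1 - k) * y + d = (1 - k) * (y + d / (1 - k)) := by field_simp
        rw [e]
        simp
        ring)
    refine ⟨Real.exp c, d / (1 - k), (1 - k)⁻¹, fun y hy => ⟨hne y hy, ?_⟩⟩
    rw [Real.rpow_def_of_pos (abs_pos.2 (hne y hy)), Real.log_abs, ← Real.exp_add,
      mul_comm _ (1 - k)⁻¹, add_comm, ← hc y hy, Real.exp_log (hpos y hy)]

end ODE

/-! ### Explicit isometries over affine maps of y. -/

/-- The candidate isometry of a plane wave covering the affine map `y ↦ κ y + τ`. -/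
noncomputable def planeWaveMap (μ κ τ α β ξ ξ' η' : ℝ) (p : Fin 4 → ℝ) : Fin 4 → ℝ :=
  ![μ * p 0 + ξ, κ * p 1 + τ, (p 2 + β * p 0 + α * p 0 * p 1) / μ + ξ',
    (p 3 - α * p 0 ^ 2 / 2) / κ + η']

/-- The inverse of `planeWaveMap`. -/
noncomputable def planeWaveMapInv (μ κ τ α β ξ ξ' η' : ℝ) (q : Fin 4 → ℝ) : Fin 4 → ℝ :=
  ![(q 0 - ξ) / μ, (q 1 - τ) / κ,
    μ * (q 2 - ξ') - β * ((q 0 - ξ) / μ) - α * ((q 0 - ξ) / μ) * ((q 1 - τ) / κ),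
    κ * (q 3 - η') + α * ((q 0 - ξ) / μ) ^ 2 / 2]

section

variable {μ κ τ α β ξ ξ' η' : ℝ}

theorem contDiff_planeWaveMap : ContDiff ℝ ∞ (planeWaveMap μ κ τ α β ξ ξ' η') := by
  rw [contDiff_pi]
  intro i
  fin_cases i <;> simp [planeWaveMap] <;> fun_prop

theorem contDiff_planeWaveMapInv : ContDiff ℝ ∞ (planeWaveMapInv μ κ τ α β ξ ξ' η') := by
  rw [contDiff_pi]
  intro i
  fin_cases i <;> simp [planeWaveMapInv] <;> fun_prop

/-- `planeWaveMap` as a homeomorphism of `ℝ⁴`. -/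
noncomputable def planeWaveHomeomorph (hμ : μ ≠ 0) (hκ : κ ≠ 0) (τ α β ξ ξ' η' : ℝ) :
    (Fin 4 → ℝ) ≃ₜ (Fin 4 → ℝ) where
  toFun := planeWaveMap μ κ τ α β ξ ξ' η'
  invFun := planeWaveMapInv μ κ τ α β ξ ξ' η'
  left_inv p := by
    ext i
    fin_cases i <;> simp [planeWaveMap, planeWaveMapInv] <;> field_simp <;> ring
  right_inv p := by
    ext i
    fin_cases i <;> simp [planeWaveMap, planeWaveMapInv] <;> field_simp <;> ring
  continuous_toFun := contDiff_planeWaveMap.continuous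
  continuous_invFun := contDiff_planeWaveMapInv.continuous

theorem fderiv_planeWaveMap (p v : Fin 4 → ℝ) :
    fderiv ℝ (planeWaveMap μ κ τ α β ξ ξ' η') p v =
      ![μ * v 0, κ * v 1, (v 2 + β * v 0 + α * (v 0 * p 1 + p 0 * v 1)) / μ,
        (v 3 - α * p 0 * v 0) / κ] := by
  have h (i : Fin 4) := hasFDerivAt_apply (𝕜 := ℝ) i p
  have h0 := ((h 0).const_mul μ).add_const ξ
  have h1 := ((h 1).const_mul κ).add_const τ
  have h2 := ((((h 2).add ((h 0).const_mul β)).add (((h 0).const_mul α).mul (h 1))).mul_const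
    μ⁻¹).add_const ξ'
  have h3 := (((h 3).sub ((((h 0).pow 2).const_mul α).mul_const (2⁻¹))).mul_const
    κ⁻¹).add_const η'
  have hd : DifferentiableAt ℝ (planeWaveMap μ κ τ α β ξ ξ' η') p :=
    contDiff_planeWaveMap.differentiable (by simp) p
  ext i
  have e : fderiv ℝ (planeWaveMap μ κ τ α β ξ ξ' η') p v i =
      fderiv ℝ (fun q => planeWaveMap μ κ τ α β ξ ξ' η' q i) p v := by
    rw [fderiv_apply hd]; rfl
  rw [e]
  fin_cases i
  · refine (congrArg (fun L => L v) h0.fderiv).trans ?_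
    simp
  · refine (congrArg (fun L => L v) h1.fderiv).trans ?_
    simp
  · refine (congrArg (fun L => L v) h2.fderiv).trans ?_
    simp; ring
  · refine (congrArg (fun L => L v) h3.fderiv).trans ?_
    simp; ring

end

section

variable {f : ℝ → ℝ} {O : Set ℝ} (hO : IsOpen O) (hf : AnalyticOnNhd ℝ f O)
include hf

/-- Integrating `hs` twice gives μ² f(κy + τ) = f(y) + αy + β. The affine error in the dx²
coefficient is absorbed by the α, β terms of the x̃-component; the mixed dx dy term they create
cancels against the quadratic term of the ỹ-component. -/
theorem exists_isLocalIsometry_planeWave (hc : Convex ℝ O) {μ κ τ : ℝ} (hμ : μ ≠ 0) (hκ : κ ≠ 0)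
    (hs : ∀ y ∈ O, κ * y + τ ∈ O →
      μ ^ 2 * κ ^ 2 * iteratedDeriv 2 f (κ * y + τ) = iteratedDeriv 2 f y)
    {p q : Fin 4 → ℝ} (hp : p 1 ∈ O) (hq : q 1 ∈ O) (hpq : κ * p 1 + τ = q 1) :
    ∃ φ : OpenPartialHomeomorph (Fin 4 → ℝ) (Fin 4 → ℝ),
      (planeWave f O hO hf).IsLocalIsometry φ ∧ p ∈ φ.source ∧ φ p = q := by
  -- Both y and its image must lie in O; convexity of this set is what permits integration with a
  -- single constant.
  set W : Set ℝ := O ∩ (fun y => κ * y + τ) ⁻¹' O with hW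
  have hWo : IsOpen W := hO.inter (hO.preimage (by fun_prop))
  have hWc : Convex ℝ W := by
    refine hc.inter (convex_iff_forall_pos.2 fun x hx y hy a b ha hb hab => ?_)
    have := convex_iff_forall_pos.1 hc hx hy ha hb hab
    rw [Set.mem_preimage]
    convert this using 1
    simp only [smul_eq_mul]
    linear_combination -τ * hab
  have haff (y : ℝ) : HasDerivAt (fun y => κ * y + τ) κ y := by
    simpa using ((hasDerivAt_id y).const_mul κ).add_const τ
  obtain ⟨α, hα⟩ : ∃ α, ∀ y ∈ W,
      μ ^ 2 * κ * iteratedDeriv 1 f (κ * y + τ) = iteratedDeriv 1 f y + α := by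
    refine hWc.eq_add_const_of_hasDerivAt (w := iteratedDeriv 2 f) (fun y hy => ?_)
      (fun y hy => hasDerivAt_iteratedDeriv hf 1 hy.1)
    refine (((hasDerivAt_iteratedDeriv hf 1 hy.2).comp y (haff y)).const_mul
      (μ ^ 2 * κ)).congr_deriv ?_
    rw [← hs y hy.1 hy.2]; ring
  obtain ⟨β, hβ⟩ : ∃ β, ∀ y ∈ W, μ ^ 2 * f (κ * y + τ) = f y + α * y + β := by
    refine hWc.eq_add_const_of_hasDerivAt (w := fun y => iteratedDeriv 1 f y + α)
      (fun y hy => ?_) (fun y hy => ?_)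
    · have := ((hasDerivAt_iteratedDeriv hf 0 hy.2).comp y (haff y)).const_mul (μ ^ 2)
      simp only [iteratedDeriv_zero] at this
      refine this.congr_deriv ?_
      rw [← hα y hy]; ring
    · have := hasDerivAt_iteratedDeriv hf 0 hy.1
      simp only [iteratedDeriv_zero] at this
      exact (this.add ((hasDerivAt_id y).const_mul α)).congr_deriv (by simp)
  -- The three translation constants are those that send p to q.
  set Φ := planeWaveHomeomorph hμ hκ τ α β (q 0 - μ * p 0)
    (q 2 - (p 2 + β * p 0 + α * p 0 * p 1) / μ) (q 3 - (p 3 - α * p 0 ^ 2 / 2) / κ) with hΦ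
  have hU : IsOpen {r : Fin 4 → ℝ | r 1 ∈ W} := hWo.preimage (continuous_apply 1)
  refine ⟨Φ.toOpenPartialHomeomorph.restrOpen _ hU, ⟨?_, ?_, ?_, ?_, ?_⟩, ?_, ?_⟩
  · intro r hr
    simp at hr
    exact hr.1
  · intro r hr
    simp at hr
    have e : r 1 = κ * (Φ.symm r) 1 + τ := by
      have := congrFun (Φ.apply_symm_apply r) 1
      rw [← this]; rfl
    change r 1 ∈ O
    rw [e]
    exact hr.2
  · exact contDiff_planeWaveMap.contDiffOn
  · exact contDiff_planeWaveMapInv.contDiffOn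
  · intro r hr v w
    simp at hr
    have e := hβ (r 1) hr
    change (planeWave f O hO hf).inner (planeWaveMap _ _ _ _ _ _ _ _ r)
      (fderiv ℝ (planeWaveMap _ _ _ _ _ _ _ _) r v)
      (fderiv ℝ (planeWaveMap _ _ _ _ _ _ _ _) r w) = _
    simp only [planeWave_inner, fderiv_planeWaveMap, planeWaveMap, Matrix.cons_val]
    field_simp
    linear_combination (-2 * v 0 * w 0) * e
  · simp [hW, hp, hpq, hq]
  · change planeWaveMap _ _ _ _ _ _ _ _ p = q
    ext i
    fin_cases i <;> simp [planeWaveMap, hpq]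

/-- Translations y ↦ y + τ work, with μ² e^(lτ) = 1. -/
theorem locallyHomogeneous_planeWave_of_exp (hc : Convex ℝ O) {a l : ℝ}
    (h : ∀ y ∈ O, iteratedDeriv 2 f y = a * Real.exp (l * y)) :
    (planeWave f O hO hf).LocallyHomogeneous := by
  intro p hp q hq
  refine exists_isLocalIsometry_planeWave hO hf hc (μ := Real.exp (-(l * (q 1 - p 1)) / 2)) (κ := 1)
    (τ := q 1 - p 1) (Real.exp_pos _).ne' one_ne_zero (fun y hy hy' => ?_) hp hq (by ring)
  rw [h y hy, h _ hy', ← Real.exp_nat_mul, one_pow, mul_one, mul_left_comm, ← Real.exp_add]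
  congr 2
  push_cast
  ring

/-- Dilations about −b work: y + b ↦ κ(y + b), with μ²κ²|κ|ᶜ = 1. -/
theorem locallyHomogeneous_planeWave_of_rpow (hc : Convex ℝ O) {a b c : ℝ}
    (h : ∀ y ∈ O, y + b ≠ 0 ∧ iteratedDeriv 2 f y = a * |y + b| ^ c) :
    (planeWave f O hO hf).LocallyHomogeneous := by
  intro p hp q hq
  have hp0 := (h _ hp).1
  have hq0 := (h _ hq).1
  set κ := (q 1 + b) / (p 1 + b) with hκ
  have hκ0 : κ ≠ 0 := div_ne_zero hq0 hp0
  have hk : 0 < |κ| := abs_pos.2 hκ0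
  refine exists_isLocalIsometry_planeWave hO hf hc (μ := |κ|⁻¹ * |κ| ^ (-c / 2)) (κ := κ)
    (τ := b * (κ - 1)) (by positivity) hκ0 (fun y hy hy' => ?_) hp hq ?_
  · have e : (|κ| ^ (-c / 2)) ^ 2 * |κ| ^ c = 1 := by
      rw [← Real.rpow_natCast, ← Real.rpow_mul hk.le, ← Real.rpow_add hk]
      convert Real.rpow_zero _ using 2
      push_cast; ring
    have e' : κ * y + b * (κ - 1) + b = κ * (y + b) := by ring
    rw [(h y hy).2, (h _ hy').2, e', abs_mul, Real.mul_rpow hk.le (abs_nonneg _), ← sq_abs κ]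
    generalize |κ| ^ (-c / 2) = m at e ⊢
    field_simp
    linear_combination (a * |y + b| ^ c) * e
  · rw [hκ]; field_simp; ring

end

/-! ### Curvature homogeneity and α₂. -/

section

variable {f : ℝ → ℝ} {O : Set ℝ} (hO : IsOpen O) (hf : AnalyticOnNhd ℝ f O)

/-- The tensors `∇ⁱR`, `i ≤ 2`, of a plane wave evaluated at `(v, w, w, v; w, …, w)`. -/
theorem nablaRAt_planeWave_apply (k : ℕ) {p : Fin 4 → ℝ} (hp : p 1 ∈ O) (v w : Fin 4 → ℝ) :
    (planeWave f O hO hf).nablaRAt k p (Fin.append ![v, w, w, v] (fun _ => w)) =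
      iteratedDeriv (k + 2) f (p 1) * (v 0 * w 1 - v 1 * w 0) ^ 2 * w 1 ^ k := by
  rw [nablaRAt_planeWave hO hf k hp, tensorOfComponents_planeWaveSymbol]
  simp only [Fin.append_left, Fin.append_right, Matrix.cons_val, Finset.prod_const,
    Finset.card_univ, Fintype.card_fin]
  ring

/-- Numerator and squared denominator of α₂ both scale by D⁴E². Positivity at p makes D, E and
f'''(q) non-zero. -/
theorem alphaTwo_eq_of_scaling {p q D E : ℝ}
    (h2p : 0 < iteratedDeriv 2 f p) (h3p : 0 < iteratedDeriv 3 f p)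
    (h2 : iteratedDeriv 2 f q * D ^ 2 = iteratedDeriv 2 f p)
    (h3 : iteratedDeriv 3 f q * D ^ 2 * E = iteratedDeriv 3 f p)
    (h4 : iteratedDeriv 4 f q * D ^ 2 * E ^ 2 = iteratedDeriv 4 f p) :
    alphaTwo f p = alphaTwo f q := by
  have hD : D ≠ 0 := by rintro rfl; simp [← h2] at h2p
  have hE : E ≠ 0 := by rintro rfl; simp [← h3] at h3p
  have h3q : iteratedDeriv 3 f q ≠ 0 := by intro h; simp [← h3, h] at h3p
  rw [alphaTwo, alphaTwo, ← h2, ← h3, ← h4]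
  field_simp

/-- The composite of Φ with the inverse of Ψ matches ∇ⁱR at the two points. Evaluating on the images
v, w of ∂x, ∂y gives the scaling with D = (dx∧dy)(v, w) and E = dy(w). -/
theorem alphaTwo_eq_of_curvatureHomogeneous
    (hf2 : ∀ y ∈ O, 0 < iteratedDeriv 2 f y) (hf3 : ∀ y ∈ O, 0 < iteratedDeriv 3 f y)
    (h : (planeWave f O hO hf).CurvatureHomogeneous 2) {y z : ℝ} (hy : y ∈ O) (hz : z ∈ O) :
    alphaTwo f y = alphaTwo f z := by
  obtain ⟨U, hU⟩ := h
  obtain ⟨Φ, -, hΦ⟩ := hU (fun _ => y) hy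
  obtain ⟨Ψ, -, hΨ⟩ := hU (fun _ => z) hz
  set v : Fin 4 → ℝ := Ψ.symm (Φ (Pi.single 0 1)) with hv
  set w : Fin 4 → ℝ := Ψ.symm (Φ (Pi.single 1 1)) with hw
  have key (i : Fin 3) : iteratedDeriv (i + 2) f z * (v 0 * w 1 - v 1 * w 0) ^ 2 * w 1 ^ (i : ℕ) =
      iteratedDeriv (i + 2) f y := by
    have e1 := nablaRAt_planeWave_apply hO hf i (p := fun _ => y) hy
      (Pi.single 0 1) (Pi.single 1 1)
    have e2 := nablaRAt_planeWave_apply hO hf i (p := fun _ => z) hz v w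
    rw [← hΦ i, MultilinearMap.compLinearMap_apply] at e1
    rw [← hΨ i, MultilinearMap.compLinearMap_apply] at e2
    rw [← e2]
    -- The inserted factors equal 1; they bring the value into the shape of `e1`.
    have e3 : iteratedDeriv (i + 2) f y = iteratedDeriv (i + 2) f y *
      ((Pi.single 0 1 : Fin 4 → ℝ) 0 * (Pi.single 1 1 : Fin 4 → ℝ) 1
        - (Pi.single 0 1 : Fin 4 → ℝ) 1 * (Pi.single 1 1 : Fin 4 → ℝ) 0) ^ 2
        * (Pi.single 1 1 : Fin 4 → ℝ) 1 ^ (i : ℕ) := by simp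
    rw [e3, ← e1]
    congr 1
    ext s : 1
    refine Fin.addCases (fun t => ?_) (fun t => ?_) s
    · fin_cases t <;> simp [hv, hw]
    · simp [hw]
  refine alphaTwo_eq_of_scaling (hf2 y hy) (hf3 y hy) (D := v 0 * w 1 - v 1 * w 0) (E := w 1)
    ?_ ?_ ?_
  · simpa using key 0
  · simpa using key 1
  · exact key 2

/-- The model space of a plane wave with `f'' = f''' = 1`, `f'''' = k` at some point. -/
noncomputable def planeWaveModel (k : ℝ) : CurvatureModel 2 where
  V := Fin 4 → ℝ
  inner := Matrix.toBilin' (planeWaveMatrix 0 0)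
  inner_symm := by
    refine ⟨fun v w => ?_⟩
    simp [planeWaveMatrix, Matrix.toBilin'_apply, Fin.sum_univ_four]
    ring
  inner_nondegenerate := by
    refine Matrix.Nondegenerate.toBilin' (Matrix.nondegenerate_of_det_ne_zero ?_)
    simp [planeWaveMatrix, Matrix.det_succ_row_zero, Fin.sum_univ_succ, Fin.succAbove]
  A i := ![1, 1, k] i • tensorOfComponents (planeWaveSymbol i)

/-- The linear map `(x, y, x̃, ỹ) ↦ (μ x, κ y, (x̃ - c x) / μ, ỹ / κ)`. -/
noncomputable def planeWaveFrame {μ κ : ℝ} (hμ : μ ≠ 0) (hκ : κ ≠ 0) (c : ℝ) :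
    (Fin 4 → ℝ) ≃ₗ[ℝ] (Fin 4 → ℝ) where
  toFun v := ![μ * v 0, κ * v 1, (v 2 - c * v 0) / μ, v 3 / κ]
  invFun v := ![v 0 / μ, v 1 / κ, μ * v 2 + c * (v 0 / μ), κ * v 3]
  map_add' v w := by ext i; fin_cases i <;> simp <;> ring
  map_smul' r v := by ext i; fin_cases i <;> simp <;> ring
  left_inv v := by ext i; fin_cases i <;> simp <;> field_simp; ring
  right_inv v := by ext i; fin_cases i <;> simp <;> field_simp

theorem curvatureHomogeneous_planeWave
    (hf2 : ∀ y ∈ O, 0 < iteratedDeriv 2 f y) (hf3 : ∀ y ∈ O, 0 < iteratedDeriv 3 f y)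
    {k : ℝ} (h : ∀ y ∈ O, alphaTwo f y = k) : (planeWave f O hO hf).CurvatureHomogeneous 2 := by
  refine ⟨planeWaveModel k, fun p hp => ?_⟩
  have h2 := hf2 _ hp
  have h3 := hf3 _ hp
  set F2 := iteratedDeriv 2 f (p 1) with hF2
  set F3 := iteratedDeriv 3 f (p 1) with hF3
  have hk : iteratedDeriv 4 f (p 1) * F2 / F3 ^ 2 = k := h _ hp
  -- The model requires f'' = (μκ)² and f''' = (μκ)²κ, which determines κ and, up to sign, μ.
  set κ := F3 / F2 with hκ
  have hκ0 : κ ≠ 0 := (div_pos h3 h2).ne'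
  set μ := √F2 / κ with hμ
  have hμ0 : μ ≠ 0 := div_ne_zero (Real.sqrt_pos.2 h2).ne' hκ0
  have hs : (√F2) ^ 2 = F2 := Real.sq_sqrt h2.le
  have hD : μ ^ 2 * κ ^ 2 = F2 := by rw [hμ]; field_simp; exact hs
  refine ⟨planeWaveFrame hμ0 hκ0 (f (p 1)), fun v w => ?_, fun i => ?_⟩
  · rw [planeWave_inner]
    change Matrix.toBilin' (planeWaveMatrix 0 0)
      ![μ * v 0, κ * v 1, (v 2 - f (p 1) * v 0) / μ, v 3 / κ]
      ![μ * w 0, κ * w 1, (w 2 - f (p 1) * w 0) / μ, w 3 / κ] = _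
    simp [planeWaveMatrix, Matrix.toBilin'_apply, Fin.sum_univ_four]
    field_simp
    ring
  · refine MultilinearMap.ext fun v => ?_
    rw [nablaRAt_planeWave hO hf i hp, tensorOfComponents_planeWaveSymbol,
      MultilinearMap.compLinearMap_apply]
    change ![1, 1, k] i * tensorOfComponents (planeWaveSymbol i)
      (fun s => planeWaveFrame hμ0 hκ0 (f (p 1)) (v s)) = _
    rw [tensorOfComponents_planeWaveSymbol]
    -- The two factors dx∧dy contribute μ²κ² = f'', each further dy contributes κ; for i = 2 this is
    -- where α₂ = k enters.
    have hc : ![1, 1, k] i * F2 * κ ^ (i : ℕ) = iteratedDeriv (i + 2) f (p 1) := by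
      fin_cases i
      · simp [hF2]
      · simp [hκ, ← hF3]; field_simp
      · simp [hκ, ← hk]; field_simp
    have hp (s : Fin (4 + (i : ℕ))) : planeWaveFrame hμ0 hκ0 (f (p 1)) (v s) 0 = μ * v s 0 ∧
      planeWaveFrame hμ0 hκ0 (f (p 1)) (v s) 1 = κ * v s 1 := ⟨rfl, rfl⟩
    simp only [hp, Finset.prod_mul_distrib, Finset.prod_const,
      Finset.card_univ, Fintype.card_fin]
    rw [← hc, ← hD]
    ring

end

/-! ### Rigidity of local isometries. -/

section

variable {f : ℝ → ℝ} {O : Set ℝ} (hO : IsOpen O) (hf : AnalyticOnNhd ℝ f O)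
  {φ : OpenPartialHomeomorph (Fin 4 → ℝ) (Fin 4 → ℝ)}

namespace PseudoRiemannianDomain

theorem IsLocalIsometry.contDiffOn_component {n : ℕ} {M : PseudoRiemannianDomain n}
    {φ : OpenPartialHomeomorph (Fin n → ℝ) (Fin n → ℝ)} (h : M.IsLocalIsometry φ) (a : Fin n) :
    ContDiffOn ℝ ∞ (fun q => φ q a) φ.source :=
  contDiffOn_pi.1 h.2.2.1 a

theorem IsLocalIsometry.fderiv_apply_eq {n : ℕ} {M : PseudoRiemannianDomain n}
    {φ : OpenPartialHomeomorph (Fin n → ℝ) (Fin n → ℝ)} (h : M.IsLocalIsometry φ) {p : Fin n → ℝ}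
    (hp : p ∈ φ.source) (i a : Fin n) :
    fderiv ℝ φ p (Pi.single i 1) a = partialDeriv i (fun q => φ q a) p := by
  have hd : DifferentiableAt ℝ φ p :=
    (h.2.2.1.contDiffAt (φ.open_source.mem_nhds hp)).differentiableAt (by simp)
  rw [partialDeriv, fderiv_apply hd]
  rfl

end PseudoRiemannianDomain

/-- The components of the pullback of the plane wave metric are those of the metric. -/
theorem planeWave_pullback (h : (planeWave f O hO hf).IsLocalIsometry φ) {p : Fin 4 → ℝ}
    (hp : p ∈ φ.source) (i j : Fin 4) :
    -2 * f (φ p 1) * (partialDeriv i (fun q => φ q 0) p * partialDeriv j (fun q => φ q 0) p)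
      + partialDeriv i (fun q => φ q 0) p * partialDeriv j (fun q => φ q 2) p
      + partialDeriv i (fun q => φ q 2) p * partialDeriv j (fun q => φ q 0) p
      + partialDeriv i (fun q => φ q 1) p * partialDeriv j (fun q => φ q 3) p
      + partialDeriv i (fun q => φ q 3) p * partialDeriv j (fun q => φ q 1) p
      = planeWaveMatrix f p i j := by
  have e := h.2.2.2.2 p hp (Pi.single i 1) (Pi.single j 1)
  rw [planeWave_inner] at e
  simp only [h.fderiv_apply_eq hp] at e
  rw [PseudoRiemannianDomain.inner, Matrix.toBilin'_single] at e
  refine Eq.trans ?_ e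
  ring

/-- The first derivatives of the pullback equations. -/
theorem planeWave_pullback_deriv (h : (planeWave f O hO hf).IsLocalIsometry φ) {p : Fin 4 → ℝ}
    (hp : p ∈ φ.source) (i j l : Fin 4) :
    -2 * (iteratedDeriv 1 f (φ p 1) * partialDeriv l (fun q => φ q 1) p
        * (partialDeriv i (fun q => φ q 0) p * partialDeriv j (fun q => φ q 0) p)
      + f (φ p 1) * (partialDeriv l (partialDeriv i (fun q => φ q 0)) p
          * partialDeriv j (fun q => φ q 0) p
        + partialDeriv i (fun q => φ q 0) p
          * partialDeriv l (partialDeriv j (fun q => φ q 0)) p))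
      + (partialDeriv l (partialDeriv i (fun q => φ q 0)) p * partialDeriv j (fun q => φ q 2) p
        + partialDeriv i (fun q => φ q 0) p * partialDeriv l (partialDeriv j (fun q => φ q 2)) p)
      + (partialDeriv l (partialDeriv i (fun q => φ q 2)) p * partialDeriv j (fun q => φ q 0) p
        + partialDeriv i (fun q => φ q 2) p * partialDeriv l (partialDeriv j (fun q => φ q 0)) p)
      + (partialDeriv l (partialDeriv i (fun q => φ q 1)) p * partialDeriv j (fun q => φ q 3) p
        + partialDeriv i (fun q => φ q 1) p * partialDeriv l (partialDeriv j (fun q => φ q 3)) p)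
      + (partialDeriv l (partialDeriv i (fun q => φ q 3)) p * partialDeriv j (fun q => φ q 1) p
        + partialDeriv i (fun q => φ q 3) p * partialDeriv l (partialDeriv j (fun q => φ q 1)) p)
      = if i = 0 ∧ j = 0 ∧ l = 1 then -2 * iteratedDeriv 1 f (p 1) else 0 := by
  have hU := φ.open_source
  have hX (a : Fin 4) : DifferentiableAt ℝ (fun q => φ q a) p :=
    ((h.contDiffOn_component a).contDiffAt (hU.mem_nhds hp)).differentiableAt (by simp)
  have hJ (a i : Fin 4) : DifferentiableAt ℝ (partialDeriv i (fun q => φ q a)) p :=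
    ((contDiffOn_partialDeriv hU (h.contDiffOn_component a)).contDiffAt
      (hU.mem_nhds hp)).differentiableAt (by simp)
  have hφ : φ p 1 ∈ O := h.2.1 (φ.map_source hp)
  have hF : HasDerivAt (fun y => -2 * f y) (-2 * iteratedDeriv 1 f (φ p 1)) (φ p 1) := by
    simpa using (hasDerivAt_iteratedDeriv hf 0 hφ).const_mul (-2)
  have hFd : DifferentiableAt ℝ (fun q => -2 * f (φ q 1)) p :=
    DifferentiableAt.comp (g := fun y => -2 * f y) p hF.differentiableAt (hX 1)
  rw [← partialDeriv_planeWaveMatrix hf (h.1 hp),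
    ← partialDeriv_congr hU hp (fun q hq => planeWave_pullback hO hf h hq i j)]
  have hm (a b : Fin 4) := (hJ a i).fun_mul (hJ b j)
  rw [partialDeriv_add ((((hFd.fun_mul (hm 0 0)).fun_add (hm 0 2)).fun_add (hm 2 0)).fun_add
      (hm 1 3)) (hm 3 1),
    partialDeriv_add (((hFd.fun_mul (hm 0 0)).fun_add (hm 0 2)).fun_add (hm 2 0)) (hm 1 3),
    partialDeriv_add ((hFd.fun_mul (hm 0 0)).fun_add (hm 0 2)) (hm 2 0),
    partialDeriv_add (hFd.fun_mul (hm 0 0)) (hm 0 2),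
    partialDeriv_mul hFd (hm 0 0), partialDeriv_mul (hJ 0 i) (hJ 0 j),
    partialDeriv_mul (hJ 0 i) (hJ 2 j), partialDeriv_mul (hJ 2 i) (hJ 0 j),
    partialDeriv_mul (hJ 1 i) (hJ 3 j), partialDeriv_mul (hJ 3 i) (hJ 1 j),
    partialDeriv_comp (F := fun q => φ q 1) hF (hX 1)]
  ring

/-- A vector `w` with `dφ(w) = ∂_{b}` satisfies `g(w, ∂_l) = g(∂_b, dφ(∂_l))`. -/
theorem exists_fderiv_eq_single (h : (planeWave f O hO hf).IsLocalIsometry φ) {p : Fin 4 → ℝ}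
    (hp : p ∈ φ.source) (b : Fin 4) : ∃ w : Fin 4 → ℝ,
      (∀ a, ∑ l, w l * partialDeriv l (fun q => φ q a) p = if a = b then 1 else 0) ∧
      ∀ l, (planeWave f O hO hf).inner p (Pi.single l 1) w =
        (planeWave f O hO hf).inner (φ p) (fderiv ℝ φ p (Pi.single l 1)) (Pi.single b 1) := by
  -- A vector in the kernel of dφ is g-orthogonal to every ∂ᵢ, hence zero by non-degeneracy.
  have hinj : Function.Injective (fderiv ℝ φ p : (Fin 4 → ℝ) →ₗ[ℝ] (Fin 4 → ℝ)) := by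
    refine (injective_iff_map_eq_zero _).2 fun v hv => ?_
    replace hv : fderiv ℝ φ p v = 0 := hv
    have e (i : Fin 4) : (planeWave f O hO hf).inner p (Pi.single i 1) v = 0 := by
      rw [← h.2.2.2.2 p hp, hv, map_zero]
    simp only [planeWave_inner] at e
    have e0 := e 2
    have e1 := e 3
    have e2 := e 0
    have e3 := e 1
    simp at e0 e1 e2 e3
    ext i
    fin_cases i <;> simp [e0, e1, e3]
    simpa [e0] using e2
  obtain ⟨w, hw⟩ := LinearMap.injective_iff_surjective.1 hinj (Pi.single b 1)
  replace hw : fderiv ℝ φ p w = Pi.single b 1 := hw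
  refine ⟨w, fun a => ?_, fun l => ?_⟩
  · have : w = ∑ l, w l • (Pi.single l 1 : Fin 4 → ℝ) := by
      ext i; simp [Finset.sum_apply, Pi.single_apply]
    have e := congrFun hw a
    rw [this, map_sum, Finset.sum_apply] at e
    simp only [map_smul, Pi.smul_apply, h.fderiv_apply_eq hp, smul_eq_mul] at e
    rw [e, Pi.single_apply]
  · rw [← h.2.2.2.2 p hp, hw]

/-- The Hessians of the first two components of a local isometry `φ` of a plane wave: the
transformation law of the Christoffel symbols. -/
theorem hessian_component (h : (planeWave f O hO hf).IsLocalIsometry φ) {a b : Fin 4}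
    (hab : a = 0 ∧ b = 2 ∨ a = 1 ∧ b = 3) {p : Fin 4 → ℝ} (hp : p ∈ φ.source) (i j : Fin 4) :
    partialDeriv i (partialDeriv j (fun q => φ q a)) p =
      iteratedDeriv 1 f (p 1) *
        ((if i = 0 ∧ j = 0 then 1 else 0) * partialDeriv 3 (fun q => φ q a) p
        - (if i = 0 ∧ j = 1 ∨ i = 1 ∧ j = 0 then 1 else 0)
          * partialDeriv 2 (fun q => φ q a) p) := by
  obtain ⟨w, hw, hg⟩ := exists_fderiv_eq_single hO hf h hp b
  have hU := φ.open_source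
  have hc (a i j : Fin 4) : partialDeriv i (partialDeriv j (fun q => φ q a)) p =
      partialDeriv j (partialDeriv i (fun q => φ q a)) p :=
    partialDeriv_comm hU (h.contDiffOn_component a) hp
  -- The metric pairs ∂_b with coordinate a in the target and ∂₂ with coordinate 0 in the source.
  have hw0 : w 0 = partialDeriv 2 (fun q => φ q a) p := by
    have := hg 2
    simp only [planeWave_inner, h.fderiv_apply_eq hp] at this
    rcases hab with ⟨rfl, rfl⟩ | ⟨rfl, rfl⟩ <;> simpa using this
  have hw1 : w 1 = partialDeriv 3 (fun q => φ q a) p := by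
    have := hg 3
    simp only [planeWave_inner, h.fderiv_apply_eq hp] at this
    rcases hab with ⟨rfl, rfl⟩ | ⟨rfl, rfl⟩ <;> simpa using this
  -- Koszul combination of the differentiated pullback equations. The left side is g(dφ ∂ₗ, ∂ᵢ∂ⱼφ +
  -- Γ(∂ᵢφ, ∂ⱼφ)) in the target, the right side g(∇_{∂ᵢ}∂ⱼ, ∂ₗ) in the source.
  have hK (l : Fin 4) :
      partialDeriv l (fun q => φ q 0) p * (partialDeriv i (partialDeriv j (fun q => φ q 2)) p
        - 2 * f (φ p 1) * partialDeriv i (partialDeriv j (fun q => φ q 0)) p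
        - iteratedDeriv 1 f (φ p 1) * (partialDeriv i (fun q => φ q 1) p
            * partialDeriv j (fun q => φ q 0) p
          + partialDeriv j (fun q => φ q 1) p * partialDeriv i (fun q => φ q 0) p))
      + partialDeriv l (fun q => φ q 2) p * partialDeriv i (partialDeriv j (fun q => φ q 0)) p
      + partialDeriv l (fun q => φ q 1) p * (partialDeriv i (partialDeriv j (fun q => φ q 3)) p
        + iteratedDeriv 1 f (φ p 1) * (partialDeriv i (fun q => φ q 0) p
            * partialDeriv j (fun q => φ q 0) p))
      + partialDeriv l (fun q => φ q 3) p * partialDeriv i (partialDeriv j (fun q => φ q 1)) p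
      = iteratedDeriv 1 f (p 1) * ((if i = 0 ∧ j = 0 ∧ l = 1 then 1 else 0)
        - (if j = 0 ∧ l = 0 ∧ i = 1 then 1 else 0) - (if i = 0 ∧ l = 0 ∧ j = 1 then 1 else 0)) := by
    have e1 := planeWave_pullback_deriv hO hf h hp j l i
    have e2 := planeWave_pullback_deriv hO hf h hp i l j
    have e3 := planeWave_pullback_deriv hO hf h hp i j l
    rw [← mul_ite_zero] at e1 e2 e3
    simp only [hc _ l i, hc _ l j, hc _ j i] at e1 e2 e3
    have m (P : Prop) [Decidable P] : (if P then iteratedDeriv 1 f (p 1) else 0) =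
        iteratedDeriv 1 f (p 1) * if P then 1 else 0 := by simp
    simp only [m] at e1 e2 e3
    linear_combination (e1 + e2 - e3) / 2
  -- Contraction with w turns dφ(∂ₗ) into ∂_b and so isolates one coefficient: the Hessian of
  -- component a.
  have dual {A B C D : ℝ} {r : Fin 4 → ℝ}
      (hr : ∀ l, partialDeriv l (fun q => φ q 0) p * A + partialDeriv l (fun q => φ q 2) p * B
        + partialDeriv l (fun q => φ q 1) p * C + partialDeriv l (fun q => φ q 3) p * D = r l) :
      ∑ l, w l * r l = (if 0 = b then 1 else 0) * A + (if 2 = b then 1 else 0) * B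
        + (if 1 = b then 1 else 0) * C + (if 3 = b then 1 else 0) * D := by
    simp only [← hr, ← hw, Fin.sum_univ_four]
    ring
  have key := dual hK
  rcases hab with ⟨rfl, rfl⟩ | ⟨rfl, rfl⟩
  all_goals
    simp [Fin.sum_univ_four, hw0, hw1] at key
    rw [← key]
    fin_cases i <;> fin_cases j <;> simp <;> ring

/-- Integrability of the Hessian equations for X = φᵃ, in which ∂₁∂₁X, ∂ᵢ∂₂X and ∂ᵢ∂₃X all vanish.
Computing ∂₁∂₀∂₀X in two orders gives f'' ∂₃X = 0, and ∂₁∂₀∂₁X gives f'' ∂₂X = 0; then f'' > 0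
applies. -/
theorem fderiv_component (h : (planeWave f O hO hf).IsLocalIsometry φ)
    (hf2 : ∀ y ∈ O, 0 < iteratedDeriv 2 f y) {a b : Fin 4}
    (hab : a = 0 ∧ b = 2 ∨ a = 1 ∧ b = 3) {p : Fin 4 → ℝ} (hp : p ∈ φ.source) :
    partialDeriv 2 (fun q => φ q a) p = 0 ∧ partialDeriv 3 (fun q => φ q a) p = 0 := by
  have hU := φ.open_source
  have hX := h.contDiffOn_component a
  have hH {p : Fin 4 → ℝ} (hp : p ∈ φ.source) (i j : Fin 4) := hessian_component hO hf h hab hp i j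
  have hJ (i : Fin 4) : DifferentiableAt ℝ (partialDeriv i (fun q => φ q a)) p :=
    ((contDiffOn_partialDeriv hU hX).contDiffAt (hU.mem_nhds hp)).differentiableAt (by simp)
  have hcomm (i j k : Fin 4) :=
    partialDeriv_comm (i := i) (j := j) hU (contDiffOn_partialDeriv (i := k) hU hX) hp
  have hF := hasDerivAt_iteratedDeriv hf 1 (h.1 hp)
  have hFd : DifferentiableAt ℝ (fun q : Fin 4 → ℝ => iteratedDeriv 1 f (q 1)) p :=
    DifferentiableAt.comp (g := iteratedDeriv 1 f) (f := fun q : Fin 4 → ℝ => q 1) p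
      hF.differentiableAt (by fun_prop)
  have hpos := (hf2 _ (h.1 hp)).ne'
  -- the mixed third derivatives `∂_k ∂_0 ∂_0` and `∂_k ∂_0 ∂_1`
  have h00 (k : Fin 4) : partialDeriv k (partialDeriv 0 (partialDeriv 0 (fun q => φ q a))) p =
      iteratedDeriv 1 f (p 1) * partialDeriv k (partialDeriv 3 (fun q => φ q a)) p
      + partialDeriv 3 (fun q => φ q a) p * (if k = 1 then iteratedDeriv 2 f (p 1) else 0) := by
    rw [partialDeriv_congr (G := fun q => iteratedDeriv 1 f (q 1) *
        partialDeriv 3 (fun q => φ q a) q) hU hp (fun q hq => (hH hq 0 0).trans (by simp)),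
      partialDeriv_mul hFd (hJ 3), partialDeriv_comp_apply 1 hF]
    simp [eq_comm]
  have h01 (k : Fin 4) : partialDeriv k (partialDeriv 0 (partialDeriv 1 (fun q => φ q a))) p =
      - (iteratedDeriv 1 f (p 1) * partialDeriv k (partialDeriv 2 (fun q => φ q a)) p
      + partialDeriv 2 (fun q => φ q a) p * (if k = 1 then iteratedDeriv 2 f (p 1) else 0)) := by
    rw [partialDeriv_congr (G := fun q => (-1) * (iteratedDeriv 1 f (q 1) *
        partialDeriv 2 (fun q => φ q a) q)) hU hp (fun q hq => (hH hq 0 1).trans (by simp)),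
      partialDeriv_mul (by fun_prop) (hFd.fun_mul (hJ 2)), partialDeriv_mul hFd (hJ 2),
      partialDeriv_comp_apply 1 hF, partialDeriv_const]
    simp [eq_comm]
  have h10 (k : Fin 4) : partialDeriv k (partialDeriv 1 (partialDeriv 0 (fun q => φ q a))) p =
      partialDeriv k (partialDeriv 0 (partialDeriv 1 (fun q => φ q a))) p :=
    partialDeriv_congr hU hp (fun q hq => partialDeriv_comm hU hX hq)
  have h11 (k : Fin 4) :
      partialDeriv k (partialDeriv 1 (partialDeriv 1 (fun q => φ q a))) p = 0 := by
    rw [partialDeriv_congr hU hp (fun q hq => (hH hq 1 1).trans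
      (by simp : _ = (0 : ℝ))), partialDeriv_const]
  have e1 := h00 1
  rw [← hcomm 0 1 0, h10, h01, hH hp 0 2, hH hp 1 3] at e1
  have e2 := h01 1
  rw [← hcomm 0 1 1, h11, hH hp 1 2] at e2
  simp [hpos] at e1 e2
  exact ⟨e2, e1⟩

end

/-! ### Scaling of f'', f''', f'''' under a local isometry. -/

/-- `F` is differentiable at `p`, with `∂ᵢF = c` there. -/
def HasPartialDerivAt {n : ℕ} (i : Fin n) (F : (Fin n → ℝ) → ℝ) (c : ℝ) (p : Fin n → ℝ) : Prop :=
  DifferentiableAt ℝ F p ∧ partialDeriv i F p = c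

namespace HasPartialDerivAt

variable {n : ℕ} {i : Fin n} {p : Fin n → ℝ} {F G : (Fin n → ℝ) → ℝ} {c d : ℝ}

theorem add (hF : HasPartialDerivAt i F c p) (hG : HasPartialDerivAt i G d p) :
    HasPartialDerivAt i (fun q => F q + G q) (c + d) p :=
  ⟨hF.1.fun_add hG.1, by rw [partialDeriv_add hF.1 hG.1, hF.2, hG.2]⟩

theorem mul (hF : HasPartialDerivAt i F c p) (hG : HasPartialDerivAt i G d p) :
    HasPartialDerivAt i (fun q => F q * G q) (F p * d + G p * c) p :=
  ⟨hF.1.fun_mul hG.1, by rw [partialDeriv_mul hF.1 hG.1, hF.2, hG.2]⟩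

theorem const (c : ℝ) : HasPartialDerivAt i (fun _ => c) 0 p :=
  ⟨by fun_prop, partialDeriv_const c⟩

theorem const_mul (hF : HasPartialDerivAt i F c p) (a : ℝ) :
    HasPartialDerivAt i (fun q => a * F q) (a * c) p := by
  simpa using (const a).mul hF

theorem sub (hF : HasPartialDerivAt i F c p) (hG : HasPartialDerivAt i G d p) :
    HasPartialDerivAt i (fun q => F q - G q) (c - d) p := by
  simpa [sub_eq_add_neg] using hF.add (hG.const_mul (-1))

theorem comp {h : ℝ → ℝ} {h' : ℝ} (hh : HasDerivAt h h' (F p)) (hF : HasPartialDerivAt i F c p) :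
    HasPartialDerivAt i (fun q => h (F q)) (h' * c) p :=
  ⟨hh.differentiableAt.comp p hF.1, by rw [partialDeriv_comp hh hF.1, hF.2]⟩

theorem apply (k : Fin n) : HasPartialDerivAt i (fun q => q k) (if k = i then 1 else 0) p :=
  ⟨by fun_prop, partialDeriv_apply k⟩

theorem eq_of_eqOn {U : Set (Fin n → ℝ)} (hU : IsOpen U) (hp : p ∈ U)
    (hF : HasPartialDerivAt i F c p) (hG : HasPartialDerivAt i G d p) (h : ∀ q ∈ U, F q = G q) :
    c = d := by
  rw [← hF.2, ← hG.2, partialDeriv_congr hU hp h]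

theorem of_contDiffOn {U : Set (Fin n → ℝ)} (hU : IsOpen U) (hp : p ∈ U)
    (hF : ContDiffOn ℝ ∞ F U) : HasPartialDerivAt i F (partialDeriv i F p) p :=
  ⟨(hF.contDiffAt (hU.mem_nhds hp)).differentiableAt (by simp), rfl⟩

end HasPartialDerivAt

section

variable {f : ℝ → ℝ} {O : Set ℝ} (hO : IsOpen O) (hf : AnalyticOnNhd ℝ f O)
  {φ : OpenPartialHomeomorph (Fin 4 → ℝ) (Fin 4 → ℝ)}

/-- The Jacobian determinant of `(φ⁰, φ¹)` with respect to `(x, y)`. -/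
noncomputable def planeJacobian (φ : (Fin 4 → ℝ) → Fin 4 → ℝ) (p : Fin 4 → ℝ) : ℝ :=
  partialDeriv 0 (fun q => φ q 0) p * partialDeriv 1 (fun q => φ q 1) p
    - partialDeriv 1 (fun q => φ q 0) p * partialDeriv 0 (fun q => φ q 1) p

/-- The Hessian is a combination of ∂₂φᵃ and ∂₃φᵃ, which vanish throughout the source. -/
theorem hasPartialDerivAt_component (h : (planeWave f O hO hf).IsLocalIsometry φ)
    (hf2 : ∀ y ∈ O, 0 < iteratedDeriv 2 f y) {a : Fin 4} (ha : a = 0 ∨ a = 1)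
    {p : Fin 4 → ℝ} (hp : p ∈ φ.source) (i j : Fin 4) :
    HasPartialDerivAt i (partialDeriv j (fun q => φ q a)) 0 p := by
  obtain ⟨b, hab⟩ : ∃ b : Fin 4, a = 0 ∧ b = 2 ∨ a = 1 ∧ b = 3 := by
    rcases ha with rfl | rfl
    · exact ⟨2, by simp⟩
    · exact ⟨3, by simp⟩
  have h1 := HasPartialDerivAt.of_contDiffOn (i := i) φ.open_source hp
    (contDiffOn_partialDeriv (i := j) φ.open_source (h.contDiffOn_component a))
  obtain ⟨h2, h3⟩ := fderiv_component hO hf h hf2 hab hp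
  rwa [hessian_component hO hf h hab hp, h2, h3, mul_zero, mul_zero, sub_zero, mul_zero] at h1

theorem hasPartialDerivAt_planeJacobian (h : (planeWave f O hO hf).IsLocalIsometry φ)
    (hf2 : ∀ y ∈ O, 0 < iteratedDeriv 2 f y) {p : Fin 4 → ℝ} (hp : p ∈ φ.source) (i : Fin 4) :
    HasPartialDerivAt i (planeJacobian φ) 0 p := by
  have hX := hasPartialDerivAt_component hO hf h hf2 (.inl rfl) hp i
  have hY := hasPartialDerivAt_component hO hf h hf2 (.inr rfl) hp i
  have hD := ((hX 0).mul (hY 1)).sub ((hX 1).mul (hY 0))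
  simp only [mul_zero, add_zero, sub_zero] at hD
  exact hD

/-- A local isometry of a plane wave scales `f''` by the square of its plane Jacobian: the
transformation law of the curvature tensor. -/
theorem iteratedDeriv_two_planeJacobian (h : (planeWave f O hO hf).IsLocalIsometry φ)
    (hf2 : ∀ y ∈ O, 0 < iteratedDeriv 2 f y) {p : Fin 4 → ℝ} (hp : p ∈ φ.source) :
    iteratedDeriv 2 f (φ p 1) * planeJacobian φ p ^ 2 = iteratedDeriv 2 f (p 1) := by
  have hU := φ.open_source
  have hz {q : Fin 4 → ℝ} (hq : q ∈ φ.source) (i j : Fin 4) :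
      partialDeriv i (partialDeriv j (fun q => φ q 0)) q = 0 ∧
      partialDeriv i (partialDeriv j (fun q => φ q 1)) q = 0 :=
    ⟨(hasPartialDerivAt_component hO hf h hf2 (.inl rfl) hq i j).2,
      (hasPartialDerivAt_component hO hf h hf2 (.inr rfl) hq i j).2⟩
  have hc {q : Fin 4 → ℝ} (hq : q ∈ φ.source) (a : Fin 4) :
      partialDeriv 1 (partialDeriv 0 (fun q => φ q a)) q =
      partialDeriv 0 (partialDeriv 1 (fun q => φ q a)) q :=
    partialDeriv_comm hU (h.contDiffOn_component a) hq
  have hE {q : Fin 4 → ℝ} (hq : q ∈ φ.source) (i j l : Fin 4) :=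
    planeWave_pullback_deriv hO hf h hq i j l
  -- Differences of pullback equations chosen to leave only second derivatives of φ² and φ³, paired
  -- with the constant first derivatives of φ⁰ and φ¹. The same is done in `hP`.
  have hQ (q : Fin 4 → ℝ) (hq : q ∈ φ.source) :
      partialDeriv 0 (fun q => φ q 0) q * partialDeriv 0 (partialDeriv 1 (fun q => φ q 2)) q
      + partialDeriv 0 (fun q => φ q 1) q * partialDeriv 0 (partialDeriv 1 (fun q => φ q 3)) q
      - (partialDeriv 1 (fun q => φ q 0) q * partialDeriv 0 (partialDeriv 0 (fun q => φ q 2)) q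
      + partialDeriv 1 (fun q => φ q 1) q * partialDeriv 0 (partialDeriv 0 (fun q => φ q 3)) q)
      = 2 * (iteratedDeriv 1 f (φ q 1)
        * (partialDeriv 0 (fun q => φ q 0) q * planeJacobian φ q))
        - 2 * iteratedDeriv 1 f (q 1) := by
    have e1 := hE hq 0 0 1
    have e2 := hE hq 0 1 0
    simp only [hz hq, hc hq] at e1 e2
    simp at e1 e2
    rw [planeJacobian, iteratedDeriv_one]
    linear_combination e1 - e2
  have hP (q : Fin 4 → ℝ) (hq : q ∈ φ.source) :
      partialDeriv 0 (fun q => φ q 0) q * partialDeriv 1 (partialDeriv 1 (fun q => φ q 2)) q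
      + partialDeriv 0 (fun q => φ q 1) q * partialDeriv 1 (partialDeriv 1 (fun q => φ q 3)) q
      - (partialDeriv 1 (fun q => φ q 0) q * partialDeriv 0 (partialDeriv 1 (fun q => φ q 2)) q
      + partialDeriv 1 (fun q => φ q 1) q * partialDeriv 0 (partialDeriv 1 (fun q => φ q 3)) q)
      = 2 * (iteratedDeriv 1 f (φ q 1)
        * (partialDeriv 1 (fun q => φ q 0) q * planeJacobian φ q)) := by
    have e1 := hE hq 0 1 1
    have e2 := hE hq 1 1 0
    simp only [hz hq, hc hq] at e1 e2
    simp at e1 e2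
    rw [planeJacobian, iteratedDeriv_one]
    linear_combination e1 - e2
  have hX (i j : Fin 4) := hasPartialDerivAt_component hO hf h hf2 (.inl rfl) hp i j
  have hY (i j : Fin 4) := hasPartialDerivAt_component hO hf h hf2 (.inr rfl) hp i j
  have hS (a i j : Fin 4) := contDiffOn_partialDeriv (i := i) hU
    (contDiffOn_partialDeriv (i := j) hU (h.contDiffOn_component a))
  have hT (a i j k : Fin 4) := HasPartialDerivAt.of_contDiffOn (i := k) hU hp (hS a i j)
  have hD := hasPartialDerivAt_planeJacobian hO hf h hf2 hp
  have hF (i : Fin 4) := HasPartialDerivAt.comp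
    (hasDerivAt_iteratedDeriv hf 1 (h.2.1 (φ.map_source hp)))
    (HasPartialDerivAt.of_contDiffOn (i := i) hU hp (h.contDiffOn_component 1))
  have hF' (i : Fin 4) := HasPartialDerivAt.comp (F := fun q : Fin 4 → ℝ => q 1)
    (hasDerivAt_iteratedDeriv hf 1 (h.1 hp)) (HasPartialDerivAt.apply (i := i) 1)
  -- In ∂_y of `hQ` minus ∂_x of `hP` the third derivatives of φ² and φ³ cancel by symmetry, and
  -- f''(φ¹) D² = f'' remains.
  have hdQ := HasPartialDerivAt.eq_of_eqOn hU hp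
    ((((hX 1 0).mul (hT 2 0 1 1)).add ((hY 1 0).mul (hT 3 0 1 1))).sub
      (((hX 1 1).mul (hT 2 0 0 1)).add ((hY 1 1).mul (hT 3 0 0 1))))
    ((((hF 1).mul ((hX 1 0).mul (hD 1))).const_mul 2).sub ((hF' 1).const_mul 2)) hQ
  have hdP := HasPartialDerivAt.eq_of_eqOn hU hp
    ((((hX 0 0).mul (hT 2 1 1 0)).add ((hY 0 0).mul (hT 3 1 1 0))).sub
      (((hX 0 1).mul (hT 2 0 1 0)).add ((hY 0 1).mul (hT 3 0 1 0))))
    (((hF 0).mul ((hX 0 1).mul (hD 0))).const_mul 2) hP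
  have c1 (a : Fin 4) : partialDeriv 1 (partialDeriv 0 (partialDeriv 1 (fun q => φ q a))) p =
      partialDeriv 0 (partialDeriv 1 (partialDeriv 1 (fun q => φ q a))) p :=
    partialDeriv_comm hU (contDiffOn_partialDeriv hU (h.contDiffOn_component a)) hp
  have c2 (a : Fin 4) : partialDeriv 1 (partialDeriv 0 (partialDeriv 0 (fun q => φ q a))) p =
      partialDeriv 0 (partialDeriv 0 (partialDeriv 1 (fun q => φ q a))) p := by
    rw [partialDeriv_comm hU (contDiffOn_partialDeriv hU (h.contDiffOn_component a)) hp]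
    exact partialDeriv_congr hU hp fun q hq => hc hq a
  simp only [c1, c2] at hdQ
  simp at hdQ hdP
  have hDp : planeJacobian φ p = partialDeriv 0 (fun q => φ q 0) p
    * partialDeriv 1 (fun q => φ q 1) p
    - partialDeriv 1 (fun q => φ q 0) p * partialDeriv 0 (fun q => φ q 1) p := rfl
  linear_combination (hdP - hdQ) / 2
    + iteratedDeriv 2 f (φ p 1) * planeJacobian φ p * hDp

theorem alphaTwo_eq_of_isLocalIsometry (h : (planeWave f O hO hf).IsLocalIsometry φ)
    (hf2 : ∀ y ∈ O, 0 < iteratedDeriv 2 f y) (hf3 : ∀ y ∈ O, 0 < iteratedDeriv 3 f y)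
    {p : Fin 4 → ℝ} (hp : p ∈ φ.source) : alphaTwo f (p 1) = alphaTwo f (φ p 1) := by
  have hU := φ.open_source
  -- Since ∂_y C = 0, differentiating the identity in y only brings out the chain-rule factor E =
  -- ∂_yφ¹, itself constant in y, so the step can be iterated.
  have step (k : ℕ) {C : (Fin 4 → ℝ) → ℝ} (hC : ∀ q ∈ φ.source, HasPartialDerivAt 1 C 0 q)
      (he : ∀ q ∈ φ.source, iteratedDeriv k f (φ q 1) * C q = iteratedDeriv k f (q 1))
      (q : Fin 4 → ℝ) (hq : q ∈ φ.source) :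
      iteratedDeriv (k + 1) f (φ q 1) * (C q * partialDeriv 1 (fun q => φ q 1) q) =
        iteratedDeriv (k + 1) f (q 1) := by
    have e := HasPartialDerivAt.eq_of_eqOn hU hq
      ((HasPartialDerivAt.comp (hasDerivAt_iteratedDeriv hf k (h.2.1 (φ.map_source hq)))
        (HasPartialDerivAt.of_contDiffOn (i := 1) hU hq (h.contDiffOn_component 1))).mul (hC q hq))
      (HasPartialDerivAt.comp (F := fun q : Fin 4 → ℝ => q 1)
        (hasDerivAt_iteratedDeriv hf k (h.1 hq)) (HasPartialDerivAt.apply (i := 1) 1)) he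
    simp at e
    linear_combination e
  have hD2 (q : Fin 4 → ℝ) (hq : q ∈ φ.source) :
      HasPartialDerivAt 1 (fun q => planeJacobian φ q ^ 2) 0 q := by
    have := hasPartialDerivAt_planeJacobian hO hf h hf2 hq 1
    simpa [sq] using this.mul this
  have e2 (q : Fin 4 → ℝ) (hq : q ∈ φ.source) := iteratedDeriv_two_planeJacobian hO hf h hf2 hq
  have e3 := step 2 hD2 e2
  have e4 := step 3 (fun q hq => by
    simpa using (hD2 q hq).mul (hasPartialDerivAt_component hO hf h hf2 (.inr rfl) hq 1 1)) e3
  refine alphaTwo_eq_of_scaling (hf2 _ (h.1 hp)) (hf3 _ (h.1 hp)) (D := planeJacobian φ p)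
    (E := partialDeriv 1 (fun q => φ q 1) p) (e2 p hp) ?_ ?_
  · linear_combination e3 p hp
  · linear_combination e4 p hp

end

/-! ### The equivalence. -/

theorem theorem1p8 (O : Set ℝ) (hO : IsOpen O) (hOc : IsConnected O)
    (f : ℝ → ℝ) (hf : AnalyticOnNhd ℝ f O)
    (hf2 : ∀ y ∈ O, 0 < iteratedDeriv 2 f y) (hf3 : ∀ y ∈ O, 0 < iteratedDeriv 3 f y) :
    [(planeWave f O hO hf).LocallyHomogeneous,
      (planeWave f O hO hf).CurvatureHomogeneous 2,
      ∃ k : ℝ, ∀ y ∈ O, alphaTwo f y = k,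
      (∃ a b c : ℝ, ∀ y ∈ O, y + b ≠ 0 ∧ iteratedDeriv 2 f y = a * |y + b| ^ c) ∨
        (∃ a l : ℝ, ∀ y ∈ O, iteratedDeriv 2 f y = a * Real.exp (l * y))].TFAE := by
  have hconv : Convex ℝ O := hOc.isPreconnected.ordConnected.convex
  obtain ⟨y₀, hy₀⟩ := hOc.nonempty
  tfae_have 1 → 3 := fun h => by
    refine ⟨alphaTwo f y₀, fun y hy => ?_⟩
    obtain ⟨φ, hφ, hp, e⟩ := h (fun _ => y) hy (fun _ => y₀) hy₀
    have := alphaTwo_eq_of_isLocalIsometry hO hf hφ hf2 hf3 hp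
    rwa [e] at this
  tfae_have 2 → 3 := fun h =>
    ⟨alphaTwo f y₀, fun y hy => alphaTwo_eq_of_curvatureHomogeneous hO hf hf2 hf3 h hy hy₀⟩
  tfae_have 3 → 2 := fun ⟨k, hk⟩ => curvatureHomogeneous_planeWave hO hf hf2 hf3 hk
  tfae_have 3 → 4 := fun ⟨k, hk⟩ =>
    exists_power_or_exp hconv (fun y hy => hasDerivAt_iteratedDeriv hf 2 hy)
      (fun y hy => hasDerivAt_iteratedDeriv hf 3 hy) hf2 hf3 hk
  tfae_have 4 → 1 := by
    rintro (⟨a, b, c, h⟩ | ⟨a, l, h⟩)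
    · exact locallyHomogeneous_planeWave_of_rpow hO hf hconv h
    · exact locallyHomogeneous_planeWave_of_exp hO hf hconv h
  tfae_finish
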